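/- Let $\mathcal P$ be a smooth manifold, $H$ a closed 3-form on it, and let $T\oplus T^*$ carry the pairing $\langle X+\alpha,Y+\beta\rangle=\alpha(Y)+\beta(X)$ and the $H$-twisted Dorfman bracket $[X+\alpha,Y+\beta]=[X,Y]+\mathcal L_X\beta-\imath_Y d\alpha+\imath_Y\imath_X H$. Let $(\mathcal G,\mathcal K_+)$ be a generalized para-Kähler (GpK) structure with flux $H$: $\mathcal G$ is an endomorphism of $T\oplus T^*$ with $\mathcal G^2=1$, $\langle\mathcal G\cdot,\mathcal G\cdot\rangle=\langle\cdot,\cdot\rangle$, whose $\pm1$-eigenbundles $C_\pm$ project isomorphically onto $T$ by $\pi_\pm:C_\pm\to T$; $\mathcal K_+$ is an endomorphism commuting with $\mathcal G$ with $\mathcal K_+^2=1$ and $\langle\mathcal K_+\cdot,\mathcal K_+\cdot\rangle=-\langle\cdot,\cdot\rangle$; and both $\mathcal K_+$ and $\mathcal K_-=\mathcal G\mathcal K_+$ are integrable, i.e. their generalized Nijenhuis tensors for the twisted Dorfman bracket vanish. Define its bi-para-Hermitian data by $\eta(X,Y)=\frac12\langle\pi_+^{-1}X,\pi_+^{-1}Y\rangle$,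 the 2-form $b$ with $\pi_\pm^{-1}X=X+(b\pm\eta)X$ (where $b(X)=\imath_Xb$), $K_+=\pi_+\mathcal K_+\pi_+^{-1}$ and $K_-=\pi_-\mathcal K_+\pi_-^{-1}=-\pi_-\mathcal K_-\pi_-^{-1}$. For a para-Hermitian structure $(\eta,K)$ (a nondegenerate symmetric $\eta$; $K^2=1$ with $\pm1$-eigenbundles $T_\pm$ of equal rank; vanishing Nijenhuis tensor; $\eta(K\cdot,K\cdot)=-\eta$) let $\rho_{(\pm)}:T\to T_\pm\oplus T_\pm^*$, $x_++x_-\mapsto x_\pm+\eta(x_\mp)$, for $x_\pm\in T_\pm$; let $[\![X,Y]\!]_{(\pm)}=\rho_{(\pm)}^{-1}[\rho_{(\pm)}X,\rho_{(\pm)}Y]$ with the untwisted Dorfman bracket along the foliation tangent to $T_\pm$; the D-bracket of $(\eta,K)$ is $[\![X,Y]\!]=[\![X,Y]\!]_{(+)}+[\![X,Y]\!]_{(-)}$. Then $(\eta,K_+)$ and $(\eta,K_-)$ are para-Hermitian structures, and their D-brackets $[\![\cdot,\cdot]\!]_+$ and $[\![\cdot,\cdot]\!]_-$ satisfy, for all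 vector fields $X,Y,Z$, $$\eta([\![X,Y]\!]_\pm,Z)=\pm\tfrac12\langle[\pi_\pm^{-1}X,\pi_\pm^{-1}Y],\pi_\pm^{-1}Z\rangle .$$ Equivalently, $\pi_\pm^{-1}[\![X,Y]\!]_\pm=P_{C_\pm}[\pi_\pm^{-1}X,\pi_\pm^{-1}Y]$, where $P_{C_\pm}=\frac12(1\pm\mathcal G)$. Consequently the relative DFT flux $\mathcal F(X,Y,Z)=\eta([\![X,Y]\!]_+-[\![X,Y]\!]_-,Z)$ of the pair $K_\pm$ is $\mathcal F=H+db$. -/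

import Mathlib

open scoped Manifold ContDiff Bundle
open VectorField

set_option linter.unusedSectionVars false
namespace ParaGeom

noncomputable section

theorem nat_le_infty (n : ℕ) : (n : WithTop ℕ∞) ≤ ∞ := by exact_mod_cast le_top

/-! ### Smooth functions and vector fields

The vector fields of `M` are a module over the smooth functions, a Lie algebra under Mathlib's Lie
bracket `mlieBracket`, and act on functions by `⁅X, f⁆ = X f = df(X)`. Tensor fields are, as usual,
the maps on vector fields that are multilinear over the smooth functions: one-forms are
`Module.Dual (SmoothFun I M) (VF I M)`, `k`-forms are alternating maps, and endomorphisms of `T` and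
of `T ⊕ T*` are linear endomorphisms of the modules of sections. -/

section VFs
variable {E : Type*} [NormedAddCommGroup E] [NormedSpace ℝ E] [FiniteDimensional ℝ E]
  {B : Type*} [TopologicalSpace B] (I : ModelWithCorners ℝ E B)
  (M : Type*) [TopologicalSpace M] [ChartedSpace B M] [IsManifold I ∞ M]

/-- Smooth functions on `M`. -/
abbrev SmoothFun : Type _ := C^∞⟮I, M; ℝ⟯
/-- Smooth vector fields on `M`: smooth sections of the tangent bundle. -/
abbrev VF : Type _ := Cₛ^∞⟮I; E, (TangentSpace I : M → Type _)⟯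

variable {I M}

instance VF.instSMulFun : SMul (SmoothFun I M) (VF I M) where
  smul f X := ⟨fun x => f x • X x, ContMDiff.smul_section f.contMDiff X.contMDiff⟩

theorem VF.smul_apply (f : SmoothFun I M) (X : VF I M) (x : M) : (f • X) x = f x • X x := rfl

instance VF.instModuleFun : Module (SmoothFun I M) (VF I M) where
  one_smul X := by ext x; simp [VF.smul_apply]
  mul_smul f g X := by ext x; simp [VF.smul_apply, mul_smul]
  smul_zero f := by ext x; simp [VF.smul_apply]
  smul_add f X Y := by ext x; simp [VF.smul_apply]
  add_smul f g X := by ext x; simp [VF.smul_apply, add_smul]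
  zero_smul X := by ext x; simp [VF.smul_apply]

instance VF.instTower : IsScalarTower ℝ (SmoothFun I M) (VF I M) where
  smul_assoc r f X := by ext x; simp [VF.smul_apply, mul_smul]

theorem VF.mdiff (X : VF I M) (x : M) :
    MDifferentiableAt I I.tangent (fun y => (X y : TangentBundle I M)) x :=
  X.contMDiff.mdifferentiable (by simp) x

theorem SmoothFun.mdiff (f : SmoothFun I M) (x : M) : MDifferentiableAt I 𝓘(ℝ, ℝ) f x :=
  f.contMDiff.mdifferentiable (by simp) x

instance VF.instBracket : Bracket (VF I M) (VF I M) where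
  bracket X Y := ⟨mlieBracket I X Y, fun x => by
    have : CompleteSpace E := FiniteDimensional.complete ℝ E
    have : IsManifold I (minSmoothness ℝ 2) M := IsManifold.of_le (n := ∞) (by
      simpa using nat_le_infty 2)
    have : IsManifold I (((⊤ : ℕ∞) : WithTop ℕ∞) + 1) M := ‹IsManifold I ∞ M›
    exact ContMDiffAt.mlieBracket_vectorField (m := (⊤ : ℕ∞)) (n := (⊤ : ℕ∞))
      (X.contMDiff x) (Y.contMDiff x) (by simp)⟩

theorem VF.lie_apply (X Y : VF I M) (x : M) : ⁅X, Y⁆ x = mlieBracket I X Y x := rfl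

instance VF.instLieRing : LieRing (VF I M) where
  add_lie X Y Z := by
    ext x; simp [VF.lie_apply, mlieBracket_add_left (X.mdiff x) (Y.mdiff x)]
  lie_add X Y Z := by
    ext x; simp [VF.lie_apply, mlieBracket_add_right (Y.mdiff x) (Z.mdiff x)]
  lie_self X := by ext x; simp [VF.lie_apply]
  leibniz_lie X Y Z := by
    have : CompleteSpace E := FiniteDimensional.complete ℝ E
    have : IsManifold I (minSmoothness ℝ 3) M := IsManifold.of_le (n := ∞) (by simpa using nat_le_infty 3)
    have h (X : VF I M) (x : M) : ContMDiffAt I I.tangent (minSmoothness ℝ 2)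
        (fun y => (X y : TangentBundle I M)) x :=
      (X.contMDiff x).of_le (by simpa using nat_le_infty 2)
    ext x
    exact leibniz_identity_mlieBracket_apply (h X x) (h Y x) (h Z x)

instance VF.instLieAlgebra : LieAlgebra ℝ (VF I M) where
  lie_smul r X Y := by
    ext x; simp [VF.lie_apply, mlieBracket_const_smul_right (Y.mdiff x)]

instance VF.instBracketFun : Bracket (VF I M) (SmoothFun I M) where
  bracket X f := ⟨fun x => mvfderiv I f x (X x), by
    have h1 := (f.contMDiff.contMDiff_tangentMap (m := ∞) (by simp)).comp X.contMDiff
    exact (contMDiff_snd_tangentBundle_modelSpace ℝ 𝓘(ℝ, ℝ)).comp h1⟩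

theorem VF.lie_fun_apply (X : VF I M) (f : SmoothFun I M) (x : M) :
    ⁅X, f⁆ x = mvfderiv I f x (X x) := rfl

theorem VF.lie_smul_fun (X Y : VF I M) (f : SmoothFun I M) :
    ⁅X, f • Y⁆ = f • ⁅X, Y⁆ + ⁅X, f⁆ • Y := by
  ext x
  have := mlieBracket_smul_right (V := X) (SmoothFun.mdiff f x) (Y.mdiff x)
  rw [VF.lie_apply, ContMDiffSection.coe_add, Pi.add_apply, VF.smul_apply, VF.smul_apply,
    VF.lie_apply, VF.lie_fun_apply, add_comm]
  exact this

theorem VF.leibniz_fun (X Y : VF I M) (f : SmoothFun I M) :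
    ⁅X, ⁅Y, f⁆⁆ = ⁅⁅X, Y⁆, f⁆ + ⁅Y, ⁅X, f⁆⁆ := by
  have : CompleteSpace E := FiniteDimensional.complete ℝ E
  have : IsManifold I (minSmoothness ℝ 3) M := IsManifold.of_le (n := ∞) (by simpa using nat_le_infty 3)
  have h (X : VF I M) (x : M) : ContMDiffAt I I.tangent (minSmoothness ℝ 2)
      (fun y => (X y : TangentBundle I M)) x :=
    (X.contMDiff x).of_le (by simpa using nat_le_infty 2)
  ext x
  rcases subsingleton_or_nontrivial (TangentSpace I x) with hs | hn
  · have hz (Z : VF I M) (g : SmoothFun I M) : ⁅Z, g⁆ x = 0 := by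
      rw [VF.lie_fun_apply, Subsingleton.elim (Z x) 0, map_zero]
    simp [hz]
  obtain ⟨v, hv⟩ := exists_ne (0 : TangentSpace I x)
  obtain ⟨s, hs, hZs⟩ := FiberBundle.exists_contMDiffOn_extend (k := ∞) I E v
  set Z : Π y : M, TangentSpace I y := FiberBundle.extend E v with hZdef
  have hZv : Z x = v := FiberBundle.extend_apply_self E v
  have hZc : ∀ᶠ y in nhds x, ContMDiffAt I I.tangent ∞ (fun y => (Z y : TangentBundle I M)) y := by
    filter_upwards [eventually_mem_nhds_iff.2 hs] with y hy
    exact hZs.contMDiffAt hy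
  have hZx := hZc.self_of_nhds
  have hZd {y : M} (hy : ContMDiffAt I I.tangent ∞ (fun y => (Z y : TangentBundle I M)) y) :
      MDifferentiableAt I I.tangent (fun y => (Z y : TangentBundle I M)) y :=
    hy.mdifferentiableAt (by simp)
  have hfZ : ContMDiffAt I I.tangent (minSmoothness ℝ 2)
      (fun y => ((f y • Z y : TangentSpace I y) : TangentBundle I M)) x :=
    (ContMDiffAt.smul_section f.contMDiff.contMDiffAt hZx).of_le (by simpa using nat_le_infty 2)
  have hJ := leibniz_identity_mlieBracket_apply (W := fun y => f y • Z y) (h X x) (h Y x) hfZ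
  have hJZ := leibniz_identity_mlieBracket_apply (W := Z) (h X x) (h Y x)
    (hZx.of_le (by simpa using nat_le_infty 2))
  -- the product rule for the local field
  have hP (V : VF I M) (g : SmoothFun I M) : ∀ᶠ y in nhds x,
      mlieBracket I V (fun y => g y • Z y) y = ⁅V, g⁆ y • Z y + g y • mlieBracket I V Z y := by
    filter_upwards [hZc] with y hy
    exact mlieBracket_smul_right (SmoothFun.mdiff g y) (hZd hy)
  have hBc (V : VF I M) : ContMDiffAt I I.tangent ∞
      (fun y => (mlieBracket I V Z y : TangentBundle I M)) x := by
    have h2 : IsManifold I (minSmoothness ℝ 2) M :=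
      IsManifold.of_le (n := ∞) (by simpa using nat_le_infty 2)
    have h3 : IsManifold I (((⊤ : ℕ∞) : WithTop ℕ∞) + 1) M := ‹IsManifold I ∞ M›
    exact (ContMDiffAt.mlieBracket_vectorField (m := (⊤ : ℕ∞)) (n := (⊤ : ℕ∞))
      (V.contMDiff x) hZx (by simp))
  have hB (V : VF I M) : MDifferentiableAt I I.tangent
      (fun y => (mlieBracket I V Z y : TangentBundle I M)) x :=
    (hBc V).mdifferentiableAt (by simp)
  have hPP (U V : VF I M) : mlieBracket I U (mlieBracket I V (fun y => f y • Z y)) x =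
      ⁅U, ⁅V, f⁆⁆ x • Z x + ⁅V, f⁆ x • mlieBracket I U Z x
        + (⁅U, f⁆ x • mlieBracket I V Z x + f x • mlieBracket I U (mlieBracket I V Z) x) := by
    rw [Filter.EventuallyEq.mlieBracket_vectorField_eq (Filter.EventuallyEq.refl _ (U : Π y, TangentSpace I y)) (hP V f)]
    have e1 := mlieBracket_smul_right (V := U) (SmoothFun.mdiff ⁅V, f⁆ x) (hZd hZx)
    have e2 := mlieBracket_smul_right (V := U) (SmoothFun.mdiff f x) (hB V)
    have d1 : MDifferentiableAt I I.tangent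
      (fun y => (((⁅V, f⁆ : SmoothFun I M) y • Z y : TangentSpace I y) : TangentBundle I M)) x :=
      (ContMDiffAt.smul_section (n := ∞) (⁅V, f⁆ : SmoothFun I M).contMDiff.contMDiffAt hZx).mdifferentiableAt (by simp)
    have d2 : MDifferentiableAt I I.tangent
      (fun y => ((f y • mlieBracket I V Z y : TangentSpace I y) : TangentBundle I M)) x :=
      (ContMDiffAt.smul_section (n := ∞) f.contMDiff.contMDiffAt (hBc V)).mdifferentiableAt
        (by simp)
    have e3 := mlieBracket_add_right (V := U) d1 d2
    exact e3.trans (congrArg₂ _ e1 e2)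
  have hL := (hP ⁅X, Y⁆ f).self_of_nhds
  have hJ' : mlieBracket I (mlieBracket I X Y) (fun y => f y • Z y) x = _ := hL
  rw [hPP X Y, hPP Y X, hJ'] at hJ
  have hB' : mlieBracket I (⁅X, Y⁆ : VF I M) Z x = mlieBracket I (mlieBracket I X Y) Z x := rfl
  rw [hJZ, hB', hZv] at hJ
  have key : (⁅X, ⁅Y, f⁆⁆ x - (⁅⁅X, Y⁆, f⁆ x + ⁅Y, ⁅X, f⁆⁆ x)) • v = 0 := by
    rw [sub_smul, add_smul]
    have := sub_eq_zero.2 hJ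
    rw [← this]
    module
  have := (smul_eq_zero.1 key).resolve_right hv
  simpa [sub_eq_zero] using this

instance VF.instLieRingModule : LieRingModule (VF I M) (SmoothFun I M) where
  add_lie X Y f := by ext x; simp [VF.lie_fun_apply]
  lie_add X f g := by
    ext x; simp [VF.lie_fun_apply, mvfderiv_add (SmoothFun.mdiff f x) (SmoothFun.mdiff g x)]
  leibniz_lie X Y f := VF.leibniz_fun X Y f

instance VF.instLieRinehartRing : LieRinehartRing (SmoothFun I M) (VF I M) where
  lie_smul_eq_mul' f g X := by ext x; simp [VF.lie_fun_apply, VF.smul_apply]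
  leibniz_mul_right' X f g := by
    ext x
    simp [VF.lie_fun_apply, mvfderiv_mul (SmoothFun.mdiff f x) (SmoothFun.mdiff g x), mul_comm]
  leibniz_smul_right' X Y f := VF.lie_smul_fun X Y f

instance VF.instLieRinehartAlgebra : LieRinehartAlgebra ℝ (SmoothFun I M) (VF I M) where
  smul_lie r X f := by ext x; simp [VF.lie_fun_apply]
  lie_smul r X f := by
    ext x
    have := mvfderiv_mul (x := x) (f := fun _ : M => r) mdifferentiableAt_const (SmoothFun.mdiff f x)
    have h2 : ⇑(r • f : SmoothFun I M) = (fun _ : M => r) * f := rfl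
    simp [VF.lie_fun_apply, h2, this, mvfderiv_const]
end VFs
end

/-! ### Cartan calculus and Dorfman bracket of a Lie algebroid

`A` is an algebra of functions and `L` the `A`-module of sections of a Lie algebroid, i.e. a
Lie-Rinehart algebra; `⁅X, f⁆` is the derivative of the function `f` along the anchor of `X`.
Used below for `L` the vector fields of a manifold (the tangent Lie algebroid) and for `L` the
sections of an involutive subbundle (the tangent Lie algebroid of a foliation). -/

section Cartan
variable {A L : Type*} [CommRing A] [LieRing L] [Module A L] [LieRingModule L A]
  [LieRinehartRing A L]

/-- Lie derivative of a one-form. -/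
def lieDer (X : L) (β : Module.Dual A L) : Module.Dual A L where
  toFun Z := ⁅X, β Z⁆ - β ⁅X, Z⁆
  map_add' Z W := by simp; ring
  map_smul' f Z := by simp; ring

/-- The contraction `ι_Y dα` of the exterior derivative of a one-form `α`. -/
def contrD (Y : L) (α : Module.Dual A L) : Module.Dual A L where
  toFun Z := ⁅Y, α Z⁆ - ⁅Z, α Y⁆ - α ⁅Y, Z⁆
  map_add' Z W := by simp; ring
  map_smul' f Z := by simp; ring

theorem update_two (X Y Z : L) : Function.update ![X, Y, 0] 2 Z = ![X, Y, Z] := by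
  ext i; fin_cases i <;> rfl

/-- The one-form `ι_Y ι_X H`. -/
def contr₂ (H : L [⋀^Fin 3]→ₗ[A] A) (X Y : L) : Module.Dual A L where
  toFun Z := H ![X, Y, Z]
  map_add' Z W := by
    have := H.map_update_add ![X, Y, 0] 2 Z W
    rwa [update_two, update_two, update_two] at this
  map_smul' f Z := by
    have := H.map_update_smul ![X, Y, 0] 2 f Z
    rwa [update_two, update_two] at this

/-- The exterior derivative of a differential form, evaluated on vector fields. The terms
`(i, j)` of the double sum stand for the pairs `i < j + 1` of indices. -/
def extD {k : ℕ} (θ : L [⋀^Fin (k + 1)]→ₗ[A] A) (X : Fin (k + 2) → L) : A :=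
  (∑ i : Fin (k + 2), (-1 : ℤ) ^ (i : ℕ) • ⁅X i, θ (i.removeNth X)⁆) -
    ∑ i : Fin (k + 1), ∑ j ∈ Finset.Ici i, (-1 : ℤ) ^ (i + j : ℕ) •
      θ (Matrix.vecCons ⁅X i.castSucc, X j.succ⁆ (j.removeNth (i.castSucc.removeNth X)))

/-- A closed differential form. -/
def IsClosedForm {k : ℕ} (θ : L [⋀^Fin (k + 1)]→ₗ[A] A) : Prop := ∀ X, extD θ X = 0

/-- Sections of the generalized tangent bundle `T ⊕ T*`. -/
abbrev GenT (A L : Type*) [CommRing A] [LieRing L] [Module A L] : Type _ := L × Module.Dual A L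

/-- The pairing `⟨X + α, Y + β⟩ = α(Y) + β(X)`. -/
def pairing (u v : GenT A L) : A := u.2 v.1 + v.2 u.1

/-- The Dorfman bracket `[X + α, Y + β] = [X, Y] + L_X β - ι_Y dα + ι_Y ι_X H` twisted by the
flux `H`. -/
def dorfman (H : L [⋀^Fin 3]→ₗ[A] A) (u v : GenT A L) : GenT A L :=
  (⁅u.1, v.1⁆, lieDer u.1 v.2 - contrD v.1 u.2 + contr₂ H u.1 v.1)

/-- The generalized Nijenhuis tensor `[Ku, Kv] + K²[u, v] - K([Ku, v] + [u, Kv])`. -/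
def genNijenhuis (H : L [⋀^Fin 3]→ₗ[A] A) (K : Module.End A (GenT A L)) (u v : GenT A L) :
    GenT A L :=
  dorfman H (K u) (K v) + K (K (dorfman H u v)) - K (dorfman H (K u) v + dorfman H u (K v))

/-- The Nijenhuis tensor of an almost product structure. -/
def nijenhuis (K : Module.End A L) (X Y : L) : L :=
  ⁅X, Y⁆ + ⁅K X, K Y⁆ - K (⁅K X, Y⁆ + ⁅X, K Y⁆)

end Cartan


noncomputable section Structures
variable {A L : Type*} [CommRing A] [Algebra ℝ A] [LieRing L] [LieAlgebra ℝ L] [Module A L]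
  [LieRingModule L A] [LieRinehartRing A L] [LieRinehartAlgebra ℝ A L]

/-! ### Para-Hermitian structures and their D-bracket -/

/-- The `1`-eigenbundle. -/
def eigenPos {V : Type*} [AddCommGroup V] [Module A V] (K : Module.End A V) : Submodule A V :=
  LinearMap.ker (K - 1)

/-- The `-1`-eigenbundle. -/
def eigenNeg {V : Type*} [AddCommGroup V] [Module A V] (K : Module.End A V) : Submodule A V :=
  LinearMap.ker (K + 1)

theorem mem_eigenPos {V : Type*} [AddCommGroup V] [Module A V] {K : Module.End A V} {v : V} :
    v ∈ eigenPos K ↔ K v = v := by simp [eigenPos, sub_eq_zero]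

theorem mem_eigenNeg {V : Type*} [AddCommGroup V] [Module A V] {K : Module.End A V} {v : V} :
    v ∈ eigenNeg K ↔ K v = -v := by simp [eigenNeg, add_eq_zero_iff_eq_neg]

theorem eq_zero_of_add_self {V : Type*} [AddCommGroup V] [Module ℝ V] {X : V} (h : X + X = 0) :
    X = 0 := by
  have : (2 : ℝ) • X = 0 := by rw [two_smul, h]
  simpa using this

variable (A L) in
/-- A metric `η` (symmetric and inducing an isomorphism `X ↦ η(X, ·)` of `T` with `T*`) together
with an integrable product structure `K` with `η(K ·, K ·) = -η`. -/
structure ParaHermitian where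
  η : L →ₗ[A] Module.Dual A L
  symm : ∀ X Y, η X Y = η Y X
  nondeg : Function.Bijective η
  K : Module.End A L
  sq : ∀ X, K (K X) = X
  anti : ∀ X Y, η (K X) (K Y) = -η X Y
  integrable : ∀ X Y, nijenhuis K X Y = 0

namespace ParaHermitian

/-- `(η, -K)`, whose `1`-eigenbundle is the `-1`-eigenbundle of `K`. -/
def opp (S : ParaHermitian A L) : ParaHermitian A L where
  η := S.η
  symm := S.symm
  nondeg := S.nondeg
  K := -S.K
  sq X := by simp [S.sq]
  anti X Y := by simp [S.anti]
  integrable X Y := by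
    rw [← S.integrable X Y]
    simp only [nijenhuis, LinearMap.neg_apply, neg_lie, lie_neg, neg_neg, map_add, map_neg]

/-- The `1`-eigenbundle of `K`, which is involutive since `K` is integrable: the tangent
Lie algebroid of the foliation it is tangent to. -/
def leaves (S : ParaHermitian A L) : LieRinehartSubalgebra A L where
  toSubmodule := eigenPos S.K
  lie_mem' {X Y} hX hY := by
    have hX' : S.K X = X := mem_eigenPos.1 hX
    have hY' : S.K Y = Y := mem_eigenPos.1 hY
    have h := S.integrable X Y
    simp only [nijenhuis, hX', hY', map_add] at h
    refine mem_eigenPos.2 ?_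
    refine (sub_eq_zero.1 (eq_zero_of_add_self ?_)).symm
    rw [← h]; abel

theorem mem_leaves {S : ParaHermitian A L} {X : L} : X ∈ S.leaves ↔ S.K X = X := mem_eigenPos

/-- The inclusion of the `1`-eigenbundle. -/
def incl (S : ParaHermitian A L) : S.leaves →ₗ[A] L where
  toFun X := X
  map_add' _ _ := rfl
  map_smul' _ _ := rfl

/-- The projection `P = (1 + K) / 2` onto the `1`-eigenbundle. -/
def proj (S : ParaHermitian A L) : L →ₗ[A] S.leaves where
  toFun X := ⟨(1 / 2 : ℝ) • (X + S.K X), mem_leaves.2 (by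
    rw [LinearMap.map_smul_of_tower, map_add, S.sq, add_comm])⟩
  map_add' X Y := Subtype.ext (by
    change (1 / 2 : ℝ) • (X + Y + S.K (X + Y)) =
      (1 / 2 : ℝ) • (X + S.K X) + (1 / 2 : ℝ) • (Y + S.K Y)
    rw [map_add]; module)
  map_smul' f X := Subtype.ext (by
    change (1 / 2 : ℝ) • (f • X + S.K (f • X)) = f • (1 / 2 : ℝ) • (X + S.K X)
    rw [map_smul, ← smul_add, smul_comm])

theorem coe_proj (S : ParaHermitian A L) (X : L) :
    (S.proj X : L) = (1 / 2 : ℝ) • (X + S.K X) := rfl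

theorem anti_left (S : ParaHermitian A L) (X Y : L) : S.η (S.K X) Y = -S.η X (S.K Y) := by
  rw [← S.anti, S.sq]

theorem eta_leaves (S : ParaHermitian A L) {X Y : L} (hX : S.K X = X) (hY : S.K Y = Y) :
    S.η X Y = 0 := by
  have h := S.anti X Y
  rw [hX, hY] at h
  exact eq_zero_of_add_self (by nth_rewrite 1 [h]; simp)

/-- The map `T → T₊ ⊕ T₊*`, `X ↦ X₊ + η(X₋)`, where `X = X₊ + X₋` with `K X₊ = X₊` and
`K X₋ = -X₋`. -/
def rhoMap (S : ParaHermitian A L) : L →ₗ[A] GenT A S.leaves :=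
  S.proj.prod ((LinearMap.lcomp A A S.incl) ∘ₗ S.η ∘ₗ (LinearMap.id - S.incl ∘ₗ S.proj))

theorem rhoMap_apply (S : ParaHermitian A L) (X : L) :
    S.rhoMap X = (S.proj X, (S.η (X - S.proj X)).comp S.incl) := rfl

theorem rhoMap_bijective (S : ParaHermitian A L) : Function.Bijective S.rhoMap := by
  constructor
  · rw [injective_iff_map_eq_zero]
    intro X h
    rw [rhoMap_apply, Prod.mk_eq_zero] at h
    obtain ⟨h1, h2⟩ := h
    rw [h1] at h2
    have h1' : (1 / 2 : ℝ) • (X + S.K X) = 0 := congrArg Subtype.val h1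
    have hK : S.K X = -X := by
      rw [smul_eq_zero] at h1'
      exact (eq_neg_of_add_eq_zero_right (h1'.resolve_left (by norm_num)))
    refine S.nondeg.1 ?_
    rw [map_zero]
    ext Y
    have hp : S.η X (S.proj Y : L) = 0 := by
      have := LinearMap.congr_fun h2 (S.proj Y)
      rw [show ((0 : S.leaves) : L) = 0 from rfl, sub_zero] at this
      exact this
    have hm : S.η X (S.K Y) = S.η X Y := by
      have := S.anti X Y
      rw [hK, map_neg, LinearMap.neg_apply] at this
      exact neg_injective this
    rw [coe_proj, LinearMap.map_smul_of_tower, map_add, hm, smul_eq_zero] at hp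
    exact eq_zero_of_add_self (hp.resolve_left (by norm_num))
  · rintro ⟨x, ξ⟩
    obtain ⟨w, hw⟩ := S.nondeg.2 (ξ.comp S.proj)
    have hx : S.K x = x := mem_leaves.1 x.2
    have hpw : S.K (S.proj w : L) = S.proj w := mem_leaves.1 (S.proj w).2
    have hpx (y : S.leaves) : S.proj (y : L) = y := Subtype.ext (by
      rw [coe_proj, mem_leaves.1 y.2]; module)
    refine ⟨x + w - S.proj w, ?_⟩
    have hP : S.proj (x + w - S.proj w : L) = x := by
      rw [map_sub, map_add, hpx, hpx, add_sub_cancel_right]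
    rw [rhoMap_apply, hP]
    refine Prod.ext rfl ?_
    ext y
    have hy : S.K y = y := mem_leaves.1 y.2
    change S.η (x + w - S.proj w - x) y = ξ y
    have : (x + w - S.proj w - x : L) = w - S.proj w := by abel
    rw [this, map_sub, LinearMap.sub_apply, S.eta_leaves hpw hy, hw, sub_zero]
    exact congrArg ξ (hpx y)

/-- The isomorphism `ρ : T ≃ T₊ ⊕ T₊*`, `X ↦ X₊ + η(X₋)`. -/
def rho (S : ParaHermitian A L) : L ≃ₗ[A] GenT A S.leaves :=
  LinearEquiv.ofBijective S.rhoMap S.rhoMap_bijective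

/-- The bracket on `T` with `ρ ⟦X, Y⟧ = [ρ X, ρ Y]`, the right hand side being the (untwisted)
Dorfman bracket of the small Courant algebroid `T₊ ⊕ T₊*`. -/
def smallBracket (S : ParaHermitian A L) (X Y : L) : L :=
  S.rho.symm (dorfman 0 (S.rho X) (S.rho Y))

/-- The D-bracket: the sum of the brackets of the two small Courant algebroids, of the
`1`-eigenbundle and of the `-1`-eigenbundle of `K`. -/
def dBracket (S : ParaHermitian A L) (X Y : L) : L := S.smallBracket X Y + S.opp.smallBracket X Y

/-- The relative flux `F(X, Y, Z) = η(⟦X, Y⟧ - ⟦X, Y⟧', Z)`. -/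
def dftFlux (S S' : ParaHermitian A L) (X Y Z : L) : A :=
  S.η (S.dBracket X Y - S'.dBracket X Y) Z

end ParaHermitian

/-! ### Generalized para-Kähler structures -/

/-- A generalized (indefinite) metric: `G² = 1`, `G` orthogonal, and both eigenbundles `C₊`, `C₋`
isomorphic to `T` by the projection of `T ⊕ T*` onto `T`. -/
structure IsGenMetric (G : Module.End A (GenT A L)) : Prop where
  sq : ∀ u, G (G u) = u
  orth : ∀ u v, pairing (G u) (G v) = pairing u v
  nondegPos : Function.Bijective fun u : eigenPos G => u.1.1
  nondegNeg : Function.Bijective fun u : eigenNeg G => u.1.1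

/-- A generalized para-complex structure, integrable for the `H`-twisted Dorfman bracket. -/
structure IsGenParaComplex (H : L [⋀^Fin 3]→ₗ[A] A) (K : Module.End A (GenT A L)) : Prop where
  sq : ∀ u, K (K u) = u
  anti : ∀ u v, pairing (K u) (K v) = -pairing u v
  integrable : ∀ u v, genNijenhuis H K u v = 0

/-- A generalized para-Kähler structure with flux `H`: a generalized metric `G` and a commuting
generalized para-complex structure `K` (written `𝒦₊`) such that `𝒦₊` and `𝒦₋ = G 𝒦₊` are integrable
for the `H`-twisted Dorfman bracket. The metric `eta` of `G` is automatically of split signature, as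
`Kpos` below is an anti-isometry of it. -/
structure GenParaKahler (H : L [⋀^Fin 3]→ₗ[A] A) where
  G : Module.End A (GenT A L)
  K : Module.End A (GenT A L)
  metric : IsGenMetric G
  comm : ∀ u, G (K u) = K (G u)
  genPos : IsGenParaComplex H K
  genNeg : IsGenParaComplex H (G * K)

namespace GenParaKahler
variable {H : L [⋀^Fin 3]→ₗ[A] A} (S : GenParaKahler H)

/-- The projection `π₊ : C₊ ≃ T`. -/
def piPos : eigenPos S.G ≃ₗ[A] L :=
  LinearEquiv.ofBijective ((LinearMap.fst A L (Module.Dual A L)) ∘ₗ (eigenPos S.G).subtype)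
    S.metric.nondegPos

/-- The projection `π₋ : C₋ ≃ T`. -/
def piNeg : eigenNeg S.G ≃ₗ[A] L :=
  LinearEquiv.ofBijective ((LinearMap.fst A L (Module.Dual A L)) ∘ₗ (eigenNeg S.G).subtype)
    S.metric.nondegNeg

/-- `π₊⁻¹ : T → C₊ ⊆ T ⊕ T*`. -/
def liftPos : L →ₗ[A] GenT A L := (eigenPos S.G).subtype ∘ₗ S.piPos.symm.toLinearMap

/-- `π₋⁻¹ : T → C₋ ⊆ T ⊕ T*`. -/
def liftNeg : L →ₗ[A] GenT A L := (eigenNeg S.G).subtype ∘ₗ S.piNeg.symm.toLinearMap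


theorem liftPos_mem (X : L) : S.G (S.liftPos X) = S.liftPos X :=
  mem_eigenPos.1 (S.piPos.symm X).2

theorem liftNeg_mem (X : L) : S.G (S.liftNeg X) = -S.liftNeg X :=
  mem_eigenNeg.1 (S.piNeg.symm X).2

theorem liftPos_fst (X : L) : (S.liftPos X).1 = X := S.piPos.apply_symm_apply X

theorem liftNeg_fst (X : L) : (S.liftNeg X).1 = X := S.piNeg.apply_symm_apply X

theorem pairing_liftPos_liftNeg (X Y : L) : pairing (S.liftPos X) (S.liftNeg Y) = 0 := by
  have h := S.metric.orth (S.liftPos X) (S.liftNeg Y)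
  rw [S.liftPos_mem, S.liftNeg_mem] at h
  refine eq_zero_of_add_self ?_
  nth_rewrite 1 [← h]
  simp only [pairing, Prod.snd_neg, Prod.fst_neg, map_neg, LinearMap.neg_apply]
  abel

/-- The metric `η(X, Y) = ⟨π₊⁻¹ X, π₊⁻¹ Y⟩ / 2` of `G = G(η, b)`. -/
def eta : L →ₗ[A] Module.Dual A L :=
  LinearMap.mk₂ A (fun X Y => (1 / 2 : ℝ) • pairing (S.liftPos X) (S.liftPos Y))
    (fun X X' Y => by simp only [pairing, map_add, Prod.snd_add, Prod.fst_add,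
      LinearMap.add_apply]; module)
    (fun f X Y => by
      rw [smul_comm]; congr 1
      simp only [pairing, map_smul, Prod.smul_snd, Prod.smul_fst, LinearMap.smul_apply, smul_add])
    (fun X Y Y' => by simp only [pairing, map_add, Prod.snd_add, Prod.fst_add,
      LinearMap.add_apply]; module)
    (fun f X Y => by
      rw [smul_comm]; congr 1
      simp only [pairing, map_smul, Prod.smul_snd, Prod.smul_fst, LinearMap.smul_apply, smul_add])

/-- The two-form `b` of `G = G(η, b)`: the mean of the cotangent parts of `π₊⁻¹ = 1 + b + η` and
`π₋⁻¹ = 1 + b - η`. -/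
def b : L [⋀^Fin 2]→ₗ[A] A where
  toFun v := (1 / 2 : ℝ) • ((S.liftPos (v 0)).2 (v 1) + (S.liftNeg (v 0)).2 (v 1))
  map_update_add' v i X Y := by
    fin_cases i
    · simp; module
    · simp; module
  map_update_smul' v i f X := by
    fin_cases i
    · simp [mul_add]
    · simp [mul_add]
  map_eq_zero_of_eq' v i j h hij := by
    have h01 : v 0 = v 1 := by
      fin_cases i <;> fin_cases j <;> simp_all
    have := S.pairing_liftPos_liftNeg (v 1) (v 1)
    rw [pairing, S.liftPos_fst, S.liftNeg_fst] at this
    rw [h01, this, smul_zero]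

/-- `π₊⁻¹ X = X + (b + η) X`. -/
theorem liftPos_snd (X Y : L) : (S.liftPos X).2 Y = S.b ![X, Y] + S.eta X Y := by
  have h1 := S.pairing_liftPos_liftNeg X Y
  have h2 := S.pairing_liftPos_liftNeg Y X
  rw [pairing, S.liftPos_fst, S.liftNeg_fst] at h1 h2
  change _ = (1 / 2 : ℝ) • ((S.liftPos X).2 Y + (S.liftNeg X).2 Y) +
    (1 / 2 : ℝ) • ((S.liftPos X).2 (S.liftPos Y).1 + (S.liftPos Y).2 (S.liftPos X).1)
  rw [S.liftPos_fst, S.liftPos_fst, eq_neg_of_add_eq_zero_right h2]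
  module

/-- `π₋⁻¹ X = X + (b - η) X`. -/
theorem liftNeg_snd (X Y : L) : (S.liftNeg X).2 Y = S.b ![X, Y] - S.eta X Y := by
  have h2 := S.pairing_liftPos_liftNeg Y X
  rw [pairing, S.liftPos_fst, S.liftNeg_fst] at h2
  change _ = (1 / 2 : ℝ) • ((S.liftPos X).2 Y + (S.liftNeg X).2 Y) -
    (1 / 2 : ℝ) • ((S.liftPos X).2 (S.liftPos Y).1 + (S.liftPos Y).2 (S.liftPos X).1)
  rw [S.liftPos_fst, S.liftPos_fst, eq_neg_of_add_eq_zero_right h2]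
  module

/-- `K₊ = π₊ 𝒦₊ π₊⁻¹`. -/
def Kpos : Module.End A L := LinearMap.fst A L (Module.Dual A L) ∘ₗ S.K ∘ₗ S.liftPos

/-- `K₋ = π₋ 𝒦₊ π₋⁻¹`, which is also `-π₋ 𝒦₋ π₋⁻¹` since `𝒦₋ = G 𝒦₊`. -/
def Kneg : Module.End A L := LinearMap.fst A L (Module.Dual A L) ∘ₗ S.K ∘ₗ S.liftNeg

/-- The projection `(1 + G) / 2` of `T ⊕ T*` onto `C₊`. -/
def projPos (u : GenT A L) : GenT A L := (1 / 2 : ℝ) • (u + S.G u)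

/-- The projection `(1 - G) / 2` of `T ⊕ T*` onto `C₋`. -/
def projNeg (u : GenT A L) : GenT A L := (1 / 2 : ℝ) • (u - S.G u)

end GenParaKahler

end Structures

/-! ### Para-Hermitian structures on a manifold -/

noncomputable section Mfd
variable {E : Type*} [NormedAddCommGroup E] [NormedSpace ℝ E] [FiniteDimensional ℝ E]
  {B : Type*} [TopologicalSpace B] (I : ModelWithCorners ℝ E B)
  (M : Type*) [TopologicalSpace M] [ChartedSpace B M] [IsManifold I ∞ M]

variable {I M} in
/-- The fibre at `x` of the distribution spanned by a module of vector fields. -/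
def fibre (D : Submodule (SmoothFun I M) (VF I M)) (x : M) : Submodule ℝ (TangentSpace I x) :=
  (D.restrictScalars ℝ).map
    ({ toFun := fun X => X x, map_add' := fun _ _ => rfl, map_smul' := fun _ _ => rfl } :
      VF I M →ₗ[ℝ] TangentSpace I x)

/-- A para-Hermitian structure `(η, K)` on `M`; `K` is para-complex, i.e. its two eigenbundles have
the same rank. -/
structure ParaHermitianStructure extends ParaHermitian (SmoothFun I M) (VF I M) where
  rank_eq : ∀ x : M, Module.finrank ℝ (fibre (eigenPos K) x) =
    Module.finrank ℝ (fibre (eigenNeg K) x)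

end Mfd

end ParaGeom

open ParaGeom

namespace ParaGeom

/-! ### Courant algebroid axioms of the twisted Dorfman bracket -/

section Courant
variable {A L : Type*} [CommRing A] [LieRing L] [Module A L] [LieRingModule L A]
  [LieRinehartRing A L]

/-! Both sides of the bracket formula obey the same two rules: invariance of the metric
(`lie_pairing`) and exactness of the symmetric part of the bracket (`pairing_dorfman_add_swap`).
These determine `⟨[u, v], w⟩` as soon as the bracket of some two of the three arguments is known.
Let `l` be a lift of `T` into `T ⊕ T*` over the identity with `⟨lX, lY⟩ = c η(X, Y)`, and suppose
that `[lX, lY] = l[X, Y]` whenever `X, Y` lie in the same eigenbundle of `K`. Split `X, Y, Z` along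
the two eigenbundles. Among three arguments two always share an eigenbundle, so every one of the
eight components of `⟨[lX, lY], lZ⟩` is expressed by `η` and Lie brackets, and the result is `c`
times the explicit formula for the D-bracket. This is `ParaHermitian.eta_dBracket`.

It applies to `l = π₊⁻¹` with `c = 2` and to `l = π₋⁻¹` with `c = -2`. Indeed `l` carries the
eigenbundles of `K₊` and `K₋` to the four intersections of an eigenbundle of `𝒦₊` with one of `𝒦₋ =
G 𝒦₊`. Integrability makes each factor closed under the Dorfman bracket, hence the intersections
too, and there a section is determined by its tangent part (`dorfman_liftPos` and its three
variants). The same fact shows that the eigenbundles of `K₊` and `K₋` are involutive, which gives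
integrability; equality of ranks comes from `η` pairing the two isotropic eigenbundles perfectly
(`finrank_fibre_eigenPos_eq`).

The projection formula follows by nondegeneracy of `η`. For the flux, insert `π₊⁻¹ = 1 + b + η` and
`π₋⁻¹ = 1 + b - η`: the two halves add up, the `η` terms cancel, and `H + db` remains. -/

theorem pairing_comm (u v : GenT A L) : pairing u v = pairing v u := add_comm _ _

theorem pairing_add_left (u u' v : GenT A L) : pairing (u + u') v = pairing u v + pairing u' v := by
  simp only [pairing, Prod.snd_add, Prod.fst_add, LinearMap.add_apply, map_add]; ring

theorem pairing_add_right (u v v' : GenT A L) : pairing u (v + v') = pairing u v + pairing u v' := by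
  rw [pairing_comm, pairing_add_left, pairing_comm v, pairing_comm v']

theorem pairing_neg_left (u v : GenT A L) : pairing (-u) v = -pairing u v := by
  simp only [pairing, Prod.snd_neg, Prod.fst_neg, LinearMap.neg_apply, map_neg]; ring

theorem pairing_neg_right (u v : GenT A L) : pairing u (-v) = -pairing u v := by
  rw [pairing_comm, pairing_neg_left, pairing_comm]

theorem lieDer_apply (X : L) (β : Module.Dual A L) (Z : L) :
    lieDer X β Z = ⁅X, β Z⁆ - β ⁅X, Z⁆ := rfl

theorem contrD_apply (Y : L) (α : Module.Dual A L) (Z : L) :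
    contrD Y α Z = ⁅Y, α Z⁆ - ⁅Z, α Y⁆ - α ⁅Y, Z⁆ := rfl

theorem contr₂_apply (H : L [⋀^Fin 3]→ₗ[A] A) (X Y Z : L) : contr₂ H X Y Z = H ![X, Y, Z] := rfl

theorem contr₂_swap_left (H : L [⋀^Fin 3]→ₗ[A] A) (X Y Z : L) :
    contr₂ H Y X Z = -contr₂ H X Y Z := by
  rw [contr₂_apply, contr₂_apply, ← H.map_swap ![X, Y, Z] (show (0 : Fin 3) ≠ 1 by decide)]
  congr 1
  ext i; fin_cases i <;> rfl

theorem contr₂_swap_right (H : L [⋀^Fin 3]→ₗ[A] A) (X Y Z : L) :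
    contr₂ H X Z Y = -contr₂ H X Y Z := by
  rw [contr₂_apply, contr₂_apply, ← H.map_swap ![X, Y, Z] (show (1 : Fin 3) ≠ 2 by decide)]
  congr 1
  ext i; fin_cases i <;> rfl

theorem contr₂_add_left (H : L [⋀^Fin 3]→ₗ[A] A) (X X' Y Z : L) :
    contr₂ H (X + X') Y Z = contr₂ H X Y Z + contr₂ H X' Y Z := by
  -- A cyclic rotation moves the first slot to the last, where linearity is built in.
  have h (X) : contr₂ H X Y Z = contr₂ H Y Z X := by
    rw [contr₂_swap_left, contr₂_swap_right, neg_neg]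
  rw [h, h X, h X', map_add]

theorem contr₂_add_right (H : L [⋀^Fin 3]→ₗ[A] A) (X Y Y' Z : L) :
    contr₂ H X (Y + Y') Z = contr₂ H X Y Z + contr₂ H X Y' Z := by
  rw [contr₂_swap_left, contr₂_add_left, contr₂_swap_left H X Y, contr₂_swap_left H X Y']; ring

theorem dorfman_fst (H : L [⋀^Fin 3]→ₗ[A] A) (u v : GenT A L) : (dorfman H u v).1 = ⁅u.1, v.1⁆ :=
  rfl

theorem dorfman_snd_apply (H : L [⋀^Fin 3]→ₗ[A] A) (u v : GenT A L) (Z : L) :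
    (dorfman H u v).2 Z = lieDer u.1 v.2 Z - contrD v.1 u.2 Z + contr₂ H u.1 v.1 Z := rfl

theorem dorfman_add_left (H : L [⋀^Fin 3]→ₗ[A] A) (u u' v : GenT A L) :
    dorfman H (u + u') v = dorfman H u v + dorfman H u' v := by
  refine Prod.ext (by simp [dorfman_fst]) (LinearMap.ext fun Z => ?_)
  simp only [dorfman_snd_apply, Prod.snd_add, Prod.fst_add, LinearMap.add_apply, lieDer_apply,
    contrD_apply, contr₂_add_left, add_lie, lie_add, map_add]
  ring

theorem dorfman_add_right (H : L [⋀^Fin 3]→ₗ[A] A) (u v v' : GenT A L) :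
    dorfman H u (v + v') = dorfman H u v + dorfman H u v' := by
  refine Prod.ext (by simp [dorfman_fst]) (LinearMap.ext fun Z => ?_)
  simp only [dorfman_snd_apply, Prod.snd_add, Prod.fst_add, LinearMap.add_apply, lieDer_apply,
    contrD_apply, contr₂_add_right, add_lie, lie_add, map_add]
  ring

theorem dorfman_neg_left (H : L [⋀^Fin 3]→ₗ[A] A) (u v : GenT A L) :
    dorfman H (-u) v = -dorfman H u v := by
  have h := dorfman_add_left H 0 0 v
  rw [add_zero, left_eq_add] at h
  rw [eq_neg_iff_add_eq_zero, ← dorfman_add_left, neg_add_cancel, h]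

theorem dorfman_neg_right (H : L [⋀^Fin 3]→ₗ[A] A) (u v : GenT A L) :
    dorfman H u (-v) = -dorfman H u v := by
  have h := dorfman_add_right H u 0 0
  rw [add_zero, left_eq_add] at h
  rw [eq_neg_iff_add_eq_zero, ← dorfman_add_right, neg_add_cancel, h]

/-- The pairing is invariant under the Dorfman bracket. -/
theorem lie_pairing (H : L [⋀^Fin 3]→ₗ[A] A) (u v w : GenT A L) :
    ⁅u.1, pairing v w⁆ = pairing (dorfman H u v) w + pairing v (dorfman H u w) := by
  simp only [pairing, dorfman_fst, dorfman_snd_apply, lieDer_apply, contrD_apply, lie_add,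
    contr₂_swap_right H u.1 v.1 w.1, ← lie_skew v.1 w.1, map_neg]
  ring

/-- The symmetric part of the Dorfman bracket is exact. -/
theorem pairing_dorfman_add_swap (H : L [⋀^Fin 3]→ₗ[A] A) (u v w : GenT A L) :
    pairing (dorfman H u v) w + pairing (dorfman H v u) w = ⁅w.1, pairing u v⁆ := by
  simp only [pairing, dorfman_fst, dorfman_snd_apply, lieDer_apply, contrD_apply, lie_add,
    contr₂_swap_left H u.1 v.1 w.1, ← lie_skew u.1 v.1, map_neg]
  ring

end Courant

/-! ### Involutive eigenbundles and the D-bracket as a Dorfman bracket -/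

noncomputable section Structures
variable {A L : Type*} [CommRing A] [Algebra ℝ A] [LieRing L] [LieAlgebra ℝ L] [Module A L]
  [LieRingModule L A] [LieRinehartRing A L] [LieRinehartAlgebra ℝ A L]

theorem pairing_smul_left (r : ℝ) (u v : GenT A L) : pairing (r • u) v = r • pairing u v := by
  simp only [pairing, Prod.smul_snd, Prod.smul_fst, LinearMap.smul_apply, smul_add,
    LinearMap.map_smul_of_tower]

theorem self_add_eq_smul {V : Type*} [AddCommGroup V] [Module ℝ V] (X Y : V) :
    X = (1 / 2 : ℝ) • (X + Y) + (1 / 2 : ℝ) • (X - Y) := by module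

/-- An almost product structure with involutive eigenbundles is integrable. -/
theorem nijenhuis_eq_zero {K : Module.End A L} (sq : ∀ X, K (K X) = X)
    (hpos : ∀ X Y, K X = X → K Y = Y → K ⁅X, Y⁆ = ⁅X, Y⁆)
    (hneg : ∀ X Y, K X = -X → K Y = -Y → K ⁅X, Y⁆ = -⁅X, Y⁆) (X Y : L) : nijenhuis K X Y = 0 := by
  have hp (X : L) : K ((1 / 2 : ℝ) • (X + K X)) = (1 / 2 : ℝ) • (X + K X) := by
    rw [LinearMap.map_smul_of_tower, map_add, sq, add_comm]
  have hm (X : L) : K ((1 / 2 : ℝ) • (X - K X)) = -((1 / 2 : ℝ) • (X - K X)) := by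
    rw [LinearMap.map_smul_of_tower, map_sub, sq]; module
  rw [self_add_eq_smul X (K X), self_add_eq_smul Y (K Y)]
  have hxp := hp X; have hxm := hm X; have hyp := hp Y; have hym := hm Y
  set a := (1 / 2 : ℝ) • (X + K X)
  set b := (1 / 2 : ℝ) • (X - K X)
  set c := (1 / 2 : ℝ) • (Y + K Y)
  set d := (1 / 2 : ℝ) • (Y - K Y)
  have h1 := hpos a c hxp hyp
  have h2 := hneg b d hxm hym
  -- The brackets of components from opposite eigenbundles cancel identically; only `⁅a, c⁆` and
  -- `⁅b, d⁆` need involutivity.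
  simp only [nijenhuis, map_add, add_lie, lie_add, hxp, hxm, hyp, hym, h1, h2, neg_lie, lie_neg,
    neg_neg, map_neg]
  abel

/-- On `1`-eigenvectors the Nijenhuis tensor reduces to `2([u, v] - K[u, v])`, and `2` can be
cancelled over `ℝ`. -/
theorem dorfman_mem_of_genNijenhuis {H : L [⋀^Fin 3]→ₗ[A] A} {K : Module.End A (GenT A L)}
    (hK : IsGenParaComplex H K) {u v : GenT A L} (hu : K u = u) (hv : K v = v) :
    K (dorfman H u v) = dorfman H u v := by
  have h := hK.integrable u v
  rw [genNijenhuis, hu, hv, hK.sq, map_add, sub_eq_zero] at h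
  refine (sub_eq_zero.1 (eq_zero_of_add_self ?_)).symm
  rw [sub_add_sub_comm, h, sub_self]

theorem dorfman_mem_of_genNijenhuis_neg {H : L [⋀^Fin 3]→ₗ[A] A} {K : Module.End A (GenT A L)}
    (hK : IsGenParaComplex H K) {u v : GenT A L} (hu : K u = -u) (hv : K v = -v) :
    K (dorfman H u v) = -dorfman H u v := by
  have h := hK.integrable u v
  rw [genNijenhuis, hu, hv, hK.sq, map_add, sub_eq_zero, dorfman_neg_left, dorfman_neg_right,
    dorfman_neg_left, neg_neg, map_neg] at h
  refine eq_neg_of_add_eq_zero_right (eq_zero_of_add_self ?_)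
  rw [add_add_add_comm, h]; abel

namespace ParaHermitian
variable (S : ParaHermitian A L)

/-- The map `ρ` is an isometry from `η` to the pairing on `T₊ ⊕ T₊*`, because both eigenbundles of
`K` are isotropic. -/
theorem eta_smallBracket (X Y Z : L) :
    S.η (S.smallBracket X Y) Z = pairing (dorfman 0 (S.rho X) (S.rho Y)) (S.rho Z) := by
  have h (W : L) : S.η W Z = pairing (S.rho W) (S.rho Z) := by
    have e (W Z : L) : (S.rho W).2 (S.rho Z).1 = S.η (W - S.proj W) (S.proj Z) := rfl
    rw [pairing, e, e, S.symm (Z - _)]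
    have h1 : S.η (S.proj W : L) (S.proj Z) = 0 :=
      S.eta_leaves (mem_leaves.1 (S.proj W).2) (mem_leaves.1 (S.proj Z).2)
    have h2 : S.η (W - S.proj W) (Z - S.proj Z) = 0 := by
      have hK (X : L) : S.opp.K (X - S.proj X) = X - S.proj X := by
        change -(S.K (X - S.proj X)) = _
        rw [coe_proj, map_sub, LinearMap.map_smul_of_tower, map_add, S.sq]; module
      exact S.opp.eta_leaves (hK W) (hK Z)
    simp only [map_sub, LinearMap.sub_apply] at h1 h2 ⊢
    linear_combination h2 + h1
  rw [h, smallBracket, LinearEquiv.apply_symm_apply]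

/-- The bracket of the small Courant algebroid, in terms of the metric and the Lie bracket. -/
theorem eta_smallBracket_eq {x x' y y' z z' : L} (hx : S.K x = x) (hx' : S.K x' = -x')
    (hy : S.K y = y) (hy' : S.K y' = -y') (hz : S.K z = z) (hz' : S.K z' = -z') :
    S.η (S.smallBracket (x + x') (y + y')) (z + z') =
      ⁅x, S.η y' z⁆ - S.η y' ⁅x, z⁆ - (⁅y, S.η x' z⁆ - ⁅z, S.η x' y⁆ - S.η x' ⁅y, z⁆)
        + S.η z' ⁅x, y⁆ := by
  have hr {x x' : L} (hx : S.K x = x) (hx' : S.K x' = -x') :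
      S.rho (x + x') = (⟨x, mem_leaves.2 hx⟩, (S.η x').comp S.incl) := by
    have hp : S.proj (x + x') = ⟨x, mem_leaves.2 hx⟩ := Subtype.ext (by
      change _ = x
      rw [coe_proj, map_add, hx, hx']; module)
    change S.rhoMap _ = _
    rw [rhoMap_apply, hp, add_sub_cancel_left]
  rw [eta_smallBracket, hr hx hx', hr hy hy', hr hz hz', pairing, dorfman_snd_apply, contr₂_apply,
    AlternatingMap.zero_apply, add_zero]
  rfl

end ParaHermitian

/-- The D-bracket is the Dorfman bracket of a lift of `T` to `T ⊕ T*` which intertwines the brackets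
on the eigenbundles of `K`. -/
theorem ParaHermitian.eta_dBracket (S : ParaHermitian A L) {H : L [⋀^Fin 3]→ₗ[A] A}
    {l : L →ₗ[A] GenT A L} {c : ℤ} (fst : ∀ X, (l X).1 = X)
    (hη : ∀ X Y, pairing (l X) (l Y) = c • S.η X Y)
    (hpos : ∀ X Y, S.K X = X → S.K Y = Y → dorfman H (l X) (l Y) = l ⁅X, Y⁆)
    (hneg : ∀ X Y, S.K X = -X → S.K Y = -Y → dorfman H (l X) (l Y) = l ⁅X, Y⁆) (X Y Z : L) :
    c • S.η (S.dBracket X Y) Z = pairing (dorfman H (l X) (l Y)) (l Z) := by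
  have hp (X : L) : S.K ((1 / 2 : ℝ) • (X + S.K X)) = (1 / 2 : ℝ) • (X + S.K X) := by
    rw [LinearMap.map_smul_of_tower, map_add, S.sq, add_comm]
  have hm (X : L) : S.K ((1 / 2 : ℝ) • (X - S.K X)) = -((1 / 2 : ℝ) • (X - S.K X)) := by
    rw [LinearMap.map_smul_of_tower, map_sub, S.sq]; module
  suffices h : ∀ x x' y y' z z' : L, S.K x = x → S.K x' = -x' → S.K y = y → S.K y' = -y' →
      S.K z = z → S.K z' = -z' → c • S.η (S.dBracket (x + x') (y + y')) (z + z') =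
        pairing (dorfman H (l (x + x')) (l (y + y'))) (l (z + z')) by
    have := h _ _ _ _ _ _ (hp X) (hm X) (hp Y) (hm Y) (hp Z) (hm Z)
    rwa [← self_add_eq_smul, ← self_add_eq_smul, ← self_add_eq_smul] at this
  intro x x' y y' z z' hx hx' hy hy' hz hz'
  have o {x : L} (h : S.K x = -x) : S.opp.K x = x := by
    change -(S.K x) = x; rw [h, neg_neg]
  have o' {x : L} (h : S.K x = x) : S.opp.K x = -x := congrArg Neg.neg h
  have e1 := S.eta_smallBracket_eq hx hx' hy hy' hz hz'
  -- For `-K` the primed components are the ones tangent to the leaves, so the roles of the two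
  -- parts are exchanged.
  have e2 : S.η (S.opp.smallBracket (x' + x) (y' + y)) (z' + z) = _ :=
    S.opp.eta_smallBracket_eq (o hx') (o' hx) (o hy') (o' hy) (o hz') (o' hz)
  rw [add_comm x', add_comm y', add_comm z'] at e2
  change _ = ⁅x', S.η y z'⁆ - S.η y ⁅x', z'⁆ - (⁅y', S.η x z'⁆ - ⁅z', S.η x y'⁆ - S.η x ⁅y', z'⁆)
        + S.η z ⁅x', y'⁆ at e2
  have z0 {x y : L} (hx : S.K x = x) (hy : S.K y = y) : S.η x y = 0 := S.eta_leaves hx hy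
  have z0' {x y : L} (hx : S.K x = -x) (hy : S.K y = -y) : S.η x y = 0 :=
    S.opp.eta_leaves (o hx) (o hy)
  have c1 {x y : L} (hx : S.K x = x) (hy : S.K y = y) : S.K ⁅x, y⁆ = ⁅x, y⁆ :=
    mem_leaves.1 (S.leaves.lie_mem' (mem_leaves.2 hx) (mem_leaves.2 hy))
  have c2 {x y : L} (hx : S.K x = -x) (hy : S.K y = -y) : S.K ⁅x, y⁆ = -⁅x, y⁆ := by
    have : S.opp.K ⁅x, y⁆ = ⁅x, y⁆ :=
      mem_leaves.1 (S.opp.leaves.lie_mem' (mem_leaves.2 (o hx)) (mem_leaves.2 (o hy)))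
    exact neg_eq_iff_eq_neg.1 this
  -- `inv` and `sym` are the two Courant axioms pulled back along `l`. From them `s0`, `s1`, `s2`
  -- evaluate `⟨[lX, lY], lZ⟩` when the known bracket is that of the pair `(X, Y)`, `(X, Z)` or `(Y,
  -- Z)` respectively. The factor `c` is an integer, so it commutes with derivations by additivity
  -- alone.
  have inv (X Y Z : L) : ⁅X, c • S.η Y Z⁆ =
      pairing (dorfman H (l X) (l Y)) (l Z) + pairing (l Y) (dorfman H (l X) (l Z)) := by
    rw [← hη, ← lie_pairing, fst]
  have sym (X Y Z : L) : pairing (dorfman H (l X) (l Y)) (l Z) +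
      pairing (dorfman H (l Y) (l X)) (l Z) = ⁅Z, c • S.η X Y⁆ := by
    rw [pairing_dorfman_add_swap, hη, fst]
  have s0 {X Y Z : L} (h : dorfman H (l X) (l Y) = l ⁅X, Y⁆) :
      pairing (dorfman H (l X) (l Y)) (l Z) = c • S.η ⁅X, Y⁆ Z := by rw [h, hη]
  have s1 {X Y Z : L} (h : dorfman H (l X) (l Z) = l ⁅X, Z⁆) :
      pairing (dorfman H (l X) (l Y)) (l Z) = c • (⁅X, S.η Y Z⁆ - S.η Y ⁅X, Z⁆) := by
    rw [smul_sub, ← lie_zsmul, inv, h, hη]; ring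
  have s2 {X Y Z : L} (h : dorfman H (l Y) (l Z) = l ⁅Y, Z⁆) :
      pairing (dorfman H (l X) (l Y)) (l Z) =
        c • (⁅Z, S.η X Y⁆ - (⁅Y, S.η X Z⁆ - S.η X ⁅Y, Z⁆)) := by
    rw [smul_sub, ← lie_zsmul, ← sym, s1 h]; ring
  rw [dBracket, map_add S.η, LinearMap.add_apply, e1, e2]
  simp only [map_add, dorfman_add_left, dorfman_add_right, pairing_add_left, pairing_add_right]
  -- One rewrite for each of the eight components; the two with all arguments in the same
  -- eigenbundle then vanish by involutivity and isotropy.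
  rw [s0 (hpos x y hx hy), s0 (hpos x y hx hy), s0 (hneg x' y' hx' hy'), s0 (hneg x' y' hx' hy'),
    s1 (hpos x z hx hz), s1 (hneg x' z' hx' hz'), s2 (hpos y z hy hz), s2 (hneg y' z' hy' hz'),
    z0 (c1 hx hy) hz, z0' (c2 hx' hy') hz', S.symm z', S.symm z]
  simp only [zsmul_eq_mul]
  ring

end Structures
-- Pointwise arguments on the manifold: equality of ranks
section Local
variable {E : Type*} [NormedAddCommGroup E] [NormedSpace ℝ E] [FiniteDimensional ℝ E]
  {B : Type*} [TopologicalSpace B] {I : ModelWithCorners ℝ E B}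
  {M : Type*} [TopologicalSpace M] [T2Space M] [ChartedSpace B M] [IsManifold I ∞ M]

/-- Every covector is the differential of a smooth function. -/
theorem exists_mvfderiv_eq (x : M) (φ : TangentSpace I x →ₗ[ℝ] ℝ) :
    ∃ g : SmoothFun I M, ∀ v : TangentSpace I x, mvfderiv I g x v = φ v := by
  obtain ⟨ρ⟩ : Nonempty (SmoothBumpFunction I x) := inferInstance
  let ψ : E →L[ℝ] ℝ := LinearMap.toContinuousLinearMap (E := E) φ
  have hψ : ContMDiffOn I 𝓘(ℝ, ℝ) ∞ (fun y => ψ (extChartAt I x y)) (chartAt B x).source :=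
    ψ.contMDiff.comp_contMDiffOn contMDiffOn_extChartAt
  have hs := ρ.contMDiff_smul hψ
  refine ⟨⟨_, hs⟩, fun v => ?_⟩
  -- Near `x` the cut-off is invisible, and the chart centred at `x` has identity derivative there.
  have he : (fun y => ρ y • ψ (extChartAt I x y)) =ᶠ[nhds x] (ψ ∘ extChartAt I x) := by
    filter_upwards [ρ.eventuallyEq_one] with y hy
    simp [hy]
  change mfderiv I 𝓘(ℝ, ℝ) (fun y => ρ y • ψ (extChartAt I x y)) x v = _
  have : IsManifold I 1 M := IsManifold.of_le (n := ∞) (by simp)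
  rw [he.mfderiv_eq, mfderiv_comp (I' := 𝓘(ℝ, E)) x ψ.mdifferentiableAt
    (mdifferentiableAt_extChartAt (mem_chart_source B x)), mfderiv_extChartAt_self,
    ContinuousLinearMap.mfderiv_eq]
  rfl

/-- A linear functional on vector fields vanishes at the zeros of a vector field. -/
theorem dual_apply_eq_zero (ℓ : Module.Dual (SmoothFun I M) (VF I M)) {X : VF I M} {x : M}
    (hX : X x = 0) : ℓ X x = 0 := by
  obtain ⟨ρ⟩ : Nonempty (SmoothBumpFunction I x) := inferInstance
  have : IsManifold I (∞ + 1) M := ‹IsManifold I ∞ M›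
  have : IsManifold I 1 M := IsManifold.of_le (n := ∞) (by simp)
  let e := trivializationAt E (TangentSpace I : M → Type _) x
  let b := Module.finBasis ℝ E
  have hts : tsupport ρ ⊆ e.baseSet := ρ.tsupport_subset_chartAt_source
  let s (i : Fin (Module.finrank ℝ E)) : VF I M := ⟨(ρ : M → ℝ) • e.localFrame b i,
    ρ.contMDiff.contMDiffOn.smul_section_of_tsupport e.open_baseSet hts
      (e.contMDiffOn_localFrame_baseSet ∞ b i)⟩
  let c (i : Fin (Module.finrank ℝ E)) : SmoothFun I M :=
    ⟨fun y => ρ y • e.localFrameCoeff I b i y (X y),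
      ρ.contMDiff_smul (contMDiffOn_baseSet_localFrameCoeff b X.contMDiff.contMDiffOn i)⟩
  let r : SmoothFun I M := ⟨ρ, ρ.contMDiff⟩
  -- The bump function appears squared because both the local frame and the coefficients of `X` must
  -- be cut off to become global.
  have hsum : (r * r) • X = ∑ i, c i • s i := by
    ext y
    have h1 : (∑ i, c i • s i) y = ∑ i, (c i • s i) y :=
      map_sum ({ toFun := fun X => X y, map_zero' := rfl, map_add' := fun _ _ => rfl } :
        VF I M →+ TangentSpace I y) (fun i => c i • s i) Finset.univ
    rw [h1]
    change (ρ y * ρ y) • X y =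
      ∑ i, (ρ y • e.localFrameCoeff I b i y (X y)) • ρ y • e.localFrame b i y
    by_cases hy : y ∈ e.baseSet
    · conv_lhs => rw [e.eq_sum_localFrameCoeff_smul (I := I) (b := b) (s := X) hy]
      rw [Finset.smul_sum]
      exact Finset.sum_congr rfl fun i _ => by simp only [smul_smul, smul_eq_mul]; congr 1; ring
    · have : ρ y = 0 := image_eq_zero_of_notMem_tsupport fun h => hy (hts h)
      simp [this]
  have hc (i) : c i x = 0 := by
    change ρ x • e.localFrameCoeff I b i x (X x) = 0
    rw [hX, map_zero, smul_zero]
  have h2 := congrArg (fun Y => ℓ Y x) hsum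
  have h3 : (∑ i, c i • ℓ (s i)) x = ∑ i, (c i • ℓ (s i)) x :=
    map_sum ({ toFun := fun f => f x, map_zero' := rfl, map_add' := fun _ _ => rfl } :
      SmoothFun I M →+ ℝ) _ _
  simp only [map_sum, map_smul] at h2
  rw [h3] at h2
  change (ρ x * ρ x) * ℓ X x = ∑ i, c i x * ℓ (s i) x at h2
  simpa [hc, ρ.eq_one] using h2

/-- If every one-form is represented on `D` by an element of `D'`, then the fibres of `D` have at
most the dimension of those of `D'`. -/
theorem finrank_fibre_le (η : VF I M →ₗ[SmoothFun I M] Module.Dual (SmoothFun I M) (VF I M))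
    {D D' : Submodule (SmoothFun I M) (VF I M)}
    (h : ∀ α : Module.Dual (SmoothFun I M) (VF I M), ∃ Y ∈ D', ∀ X ∈ D, η Y X = α X) (x : M) :
    Module.finrank ℝ (fibre D x) ≤ Module.finrank ℝ (fibre D' x) := by
  have : FiniteDimensional ℝ (TangentSpace I x) := ‹FiniteDimensional ℝ E›
  let v := Module.finBasis ℝ (fibre D x)
  have hv (i) : ∃ X ∈ D, X x = v i := (v i).2
  choose X hXD hXv using hv
  have hg (i) : ∃ g : SmoothFun I M, ∀ u : fibre D x, mvfderiv I g x u = v.coord i u := by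
    obtain ⟨φ, hφ⟩ := LinearMap.exists_extend (v.coord i)
    obtain ⟨g, hg⟩ := exists_mvfderiv_eq x φ
    exact ⟨g, fun u => by rw [hg, ← hφ]; rfl⟩
  choose g hg using hg
  -- The exact form `dg i` is a global one-form whose value at `x` restricts to the `i`-th dual
  -- basis covector of the fibre of `D`.
  have hY (i) := h { toFun := fun X => ⁅X, g i⁆, map_add' := fun _ _ => add_lie _ _ _,
                     map_smul' := fun _ _ => LieRinehartRing.lie_smul_eq_mul _ _ _ }
  choose Y hYD hY using hY
  -- The values at `x` of the `Y i` are dual under `η` to a basis of the fibre of `D`, hence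
  -- independent.
  have hδ (i j) : η (Y i) (X j) x = if i = j then 1 else 0 := by
    rw [hY i _ (hXD j)]
    change mvfderiv I (g i) x (X j x) = _
    rw [hXv, hg, Module.Basis.coord_apply, Module.Basis.repr_self, Finsupp.single_apply]
    simp only [eq_comm]
  let ev : VF I M →ₗ[ℝ] TangentSpace I x :=
    { toFun := fun X => X x, map_add' := fun _ _ => rfl, map_smul' := fun _ _ => rfl }
  let w (i) : fibre D' x := ⟨ev (Y i), Y i, hYD i, rfl⟩
  have hw : LinearIndependent ℝ w := by
    rw [Fintype.linearIndependent_iff]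
    intro c hc j
    have h0 : (∑ i, c i • Y i) x = 0 := by
      change ev _ = 0
      have := congrArg (fibre D' x).subtype hc
      simpa [w] using this
    -- The relation holds only at the point `x`; tensoriality is what allows pairing it with `X j`.
    have h1 := dual_apply_eq_zero (η.flip (X j)) h0
    let evf : SmoothFun I M →ₗ[ℝ] ℝ :=
      { toFun := fun f => f x, map_add' := fun _ _ => rfl, map_smul' := fun _ _ => rfl }
    change evf _ = 0 at h1
    rw [map_sum, map_sum] at h1
    simp only [LinearMap.map_smul_of_tower, map_smul] at h1
    change ∑ i, c i • η (Y i) (X j) x = 0 at h1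
    simpa [hδ] using h1
  simpa using hw.fintype_card_le_finrank

/-- Each eigenbundle is isotropic, so on the `1`-eigenbundle every one-form is represented through
`η` by a section of the `-1`-eigenbundle. This bounds one rank by the other, and replacing `K` by
`-K` gives the converse. -/
theorem finrank_fibre_eigenPos_eq (S : ParaHermitian (SmoothFun I M) (VF I M)) (x : M) :
    Module.finrank ℝ (fibre (eigenPos S.K) x) = Module.finrank ℝ (fibre (eigenNeg S.K) x) := by
  have key (S : ParaHermitian (SmoothFun I M) (VF I M)) :
      Module.finrank ℝ (fibre (eigenPos S.K) x) ≤ Module.finrank ℝ (fibre (eigenPos S.opp.K) x) := by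
    refine finrank_fibre_le S.η (fun α => ?_) x
    obtain ⟨Y, rfl⟩ := S.nondeg.2 α
    -- Only the `-1`-component of `Y` pairs nontrivially with the `1`-eigenbundle.
    refine ⟨S.opp.proj Y, (S.opp.proj Y).2, fun X hX => ?_⟩
    have hX : S.K X = X := mem_eigenPos.1 hX
    have h := S.anti Y X
    rw [hX] at h
    rw [ParaHermitian.coe_proj, LinearMap.map_smul_of_tower]
    change (1 / 2 : ℝ) • S.η (Y + -(S.K Y)) X = _
    rw [map_add, map_neg, LinearMap.add_apply, LinearMap.neg_apply, h]
    module
  have hopp (S : ParaHermitian (SmoothFun I M) (VF I M)) : eigenPos S.opp.K = eigenNeg S.K := by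
    ext X
    rw [mem_eigenPos, mem_eigenNeg]
    exact neg_eq_iff_eq_neg
  have h2 := key S.opp
  have hoo : S.opp.opp.K = S.K := neg_neg S.K
  rw [hoo] at h2
  rw [← hopp]
  exact le_antisymm (key S) h2

end Local
-- Bi-para-Hermitian data of a generalized para-Kähler structure
noncomputable section Kahler
variable {A L : Type*} [CommRing A] [Algebra ℝ A] [LieRing L] [LieAlgebra ℝ L] [Module A L]
  [LieRingModule L A] [LieRinehartRing A L] [LieRinehartAlgebra ℝ A L]

namespace GenParaKahler
variable {H : L [⋀^Fin 3]→ₗ[A] A} (S : GenParaKahler H)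

theorem eq_liftPos {u : GenT A L} (hu : S.G u = u) : u = S.liftPos u.1 := by
  have := S.piPos.symm_apply_apply ⟨u, mem_eigenPos.2 hu⟩
  exact (congrArg Subtype.val this).symm

theorem eq_liftNeg {u : GenT A L} (hu : S.G u = -u) : u = S.liftNeg u.1 := by
  have := S.piNeg.symm_apply_apply ⟨u, mem_eigenNeg.2 hu⟩
  exact (congrArg Subtype.val this).symm

theorem K_liftPos (X : L) : S.K (S.liftPos X) = S.liftPos (S.Kpos X) :=
  S.eq_liftPos (by rw [S.comm, S.liftPos_mem])

theorem K_liftNeg (X : L) : S.K (S.liftNeg X) = S.liftNeg (S.Kneg X) :=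
  S.eq_liftNeg (by rw [S.comm, S.liftNeg_mem, map_neg])

theorem Kpos_sq (X : L) : S.Kpos (S.Kpos X) = X := by
  change (S.K (S.liftPos (S.Kpos X))).1 = X
  rw [← K_liftPos, S.genPos.sq, liftPos_fst]

theorem Kneg_sq (X : L) : S.Kneg (S.Kneg X) = X := by
  change (S.K (S.liftNeg (S.Kneg X))).1 = X
  rw [← K_liftNeg, S.genPos.sq, liftNeg_fst]

theorem eta_symm (X Y : L) : S.eta X Y = S.eta Y X :=
  congrArg ((1 / 2 : ℝ) • ·) (pairing_comm (S.liftPos X) (S.liftPos Y))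

theorem pairing_liftPos (X Y : L) : pairing (S.liftPos X) (S.liftPos Y) = (2 : ℤ) • S.eta X Y := by
  change _ = (2 : ℤ) • (1 / 2 : ℝ) • pairing (S.liftPos X) (S.liftPos Y)
  module

theorem pairing_liftNeg (X Y : L) :
    pairing (S.liftNeg X) (S.liftNeg Y) = (-2 : ℤ) • S.eta X Y := by
  have h := S.pairing_liftPos X Y
  rw [pairing, S.liftPos_fst, S.liftPos_fst, S.liftPos_snd, S.liftPos_snd, S.eta_symm Y X] at h
  rw [pairing, S.liftNeg_fst, S.liftNeg_fst, S.liftNeg_snd, S.liftNeg_snd, S.eta_symm Y X]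
  -- The computation on `C₊` is used only to know that the two `b` terms cancel.
  simp only [zsmul_eq_mul, Int.cast_neg, Int.cast_ofNat] at h ⊢
  linear_combination h

theorem eta_Kpos (X Y : L) : S.eta (S.Kpos X) (S.Kpos Y) = -S.eta X Y := by
  change (1 / 2 : ℝ) • pairing (S.liftPos _) (S.liftPos _) =
    -((1 / 2 : ℝ) • pairing (S.liftPos X) (S.liftPos Y))
  rw [← K_liftPos, ← K_liftPos, S.genPos.anti, smul_neg]

theorem eta_Kneg (X Y : L) : S.eta (S.Kneg X) (S.Kneg Y) = -S.eta X Y := by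
  have h (X Y : L) : S.eta X Y = (-(1 / 2) : ℝ) • pairing (S.liftNeg X) (S.liftNeg Y) := by
    rw [pairing_liftNeg]; module
  rw [h, h, ← K_liftNeg, ← K_liftNeg, S.genPos.anti, smul_neg]

/-- The two lifts of `X` differ by `2 η(X)`. If this vanishes, the common lift lies in `C₊ ∩ C₋ =
0`. Conversely, decomposing the section `(0, α)` along `C₊ ⊕ C₋` gives lifts of opposite vectors, so
`2α` is such a difference. -/
theorem eta_bijective : Function.Bijective S.eta := by
  constructor
  · rw [injective_iff_map_eq_zero]
    intro X hX
    have h : S.liftPos X = S.liftNeg X := by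
      refine Prod.ext (by rw [liftPos_fst, liftNeg_fst]) (LinearMap.ext fun Y => ?_)
      rw [liftPos_snd, liftNeg_snd, hX, LinearMap.zero_apply, add_zero, sub_zero]
    have h2 := S.liftNeg_mem X
    rw [← h, S.liftPos_mem] at h2
    have h3 : S.liftPos X = 0 := eq_zero_of_add_self (by nth_rewrite 1 [h2]; simp)
    rw [← S.liftPos_fst X, h3, Prod.fst_zero]
  · intro α
    let u : GenT A L := (0, α)
    have h1 := S.eq_liftPos (u := u + S.G u) (by rw [map_add, S.metric.sq, add_comm])
    have h2 := S.eq_liftNeg (u := u - S.G u) (by rw [map_sub, S.metric.sq, neg_sub])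
    have e1 : (u + S.G u).1 = (S.G u).1 := zero_add _
    have e2 : (u - S.G u).1 = -(S.G u).1 := zero_sub _
    rw [e1] at h1
    rw [e2, map_neg] at h2
    refine ⟨(S.G u).1, LinearMap.ext fun Y => ?_⟩
    have h3 : (S.liftPos (S.G u).1).2 Y - (S.liftNeg (S.G u).1).2 Y = α Y + α Y := by
      have : S.liftPos (S.G u).1 - S.liftNeg (S.G u).1 = u + u := by
        rw [sub_eq_add_neg, ← h1, ← h2]; abel
      exact LinearMap.congr_fun (congrArg Prod.snd this) Y
    rw [liftPos_snd, liftNeg_snd] at h3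
    refine sub_eq_zero.1 (eq_zero_of_add_self ?_)
    linear_combination h3

/-- The lifts are fixed by both `𝒦₊` and `G 𝒦₊`, hence so is their Dorfman bracket. It is then fixed
by `G`, so it lies in `C₊` and is the lift of its tangent part. -/
theorem dorfman_liftPos {X Y : L} (hX : S.Kpos X = X) (hY : S.Kpos Y = Y) :
    dorfman H (S.liftPos X) (S.liftPos Y) = S.liftPos ⁅X, Y⁆ ∧ S.Kpos ⁅X, Y⁆ = ⁅X, Y⁆ := by
  have hK {X : L} (hX : S.Kpos X = X) : S.K (S.liftPos X) = S.liftPos X := by rw [K_liftPos, hX]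
  have hGK {X : L} (hX : S.Kpos X = X) : (S.G * S.K) (S.liftPos X) = S.liftPos X := by
    rw [Module.End.mul_apply, hK hX, liftPos_mem]
  have h1 := dorfman_mem_of_genNijenhuis S.genPos (hK hX) (hK hY)
  have h2 := dorfman_mem_of_genNijenhuis S.genNeg (hGK hX) (hGK hY)
  rw [Module.End.mul_apply, h1] at h2
  have h3 := S.eq_liftPos h2
  rw [dorfman_fst, liftPos_fst, liftPos_fst] at h3
  refine ⟨h3, ?_⟩
  rw [h3] at h1
  change (S.K (S.liftPos _)).1 = _
  rw [h1, liftPos_fst]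

theorem dorfman_liftPos_neg {X Y : L} (hX : S.Kpos X = -X) (hY : S.Kpos Y = -Y) :
    dorfman H (S.liftPos X) (S.liftPos Y) = S.liftPos ⁅X, Y⁆ ∧ S.Kpos ⁅X, Y⁆ = -⁅X, Y⁆ := by
  have hK {X : L} (hX : S.Kpos X = -X) : S.K (S.liftPos X) = -S.liftPos X := by
    rw [K_liftPos, hX, map_neg]
  have hGK {X : L} (hX : S.Kpos X = -X) : (S.G * S.K) (S.liftPos X) = -S.liftPos X := by
    rw [Module.End.mul_apply, hK hX, map_neg, liftPos_mem]
  have h1 := dorfman_mem_of_genNijenhuis_neg S.genPos (hK hX) (hK hY)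
  have h2 := dorfman_mem_of_genNijenhuis_neg S.genNeg (hGK hX) (hGK hY)
  rw [Module.End.mul_apply, h1, map_neg, neg_inj] at h2
  have h3 := S.eq_liftPos h2
  rw [dorfman_fst, liftPos_fst, liftPos_fst] at h3
  refine ⟨h3, ?_⟩
  rw [h3] at h1
  change (S.K (S.liftPos _)).1 = _
  rw [h1, Prod.fst_neg, liftPos_fst]

/-- On `C₋` the signs of `𝒦₊` and `G 𝒦₊` are opposite, so one integrability is used on the
`1`-eigenbundle and the other on the `-1`-eigenbundle. -/
theorem dorfman_liftNeg {X Y : L} (hX : S.Kneg X = X) (hY : S.Kneg Y = Y) :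
    dorfman H (S.liftNeg X) (S.liftNeg Y) = S.liftNeg ⁅X, Y⁆ ∧ S.Kneg ⁅X, Y⁆ = ⁅X, Y⁆ := by
  have hK {X : L} (hX : S.Kneg X = X) : S.K (S.liftNeg X) = S.liftNeg X := by rw [K_liftNeg, hX]
  have hGK {X : L} (hX : S.Kneg X = X) : (S.G * S.K) (S.liftNeg X) = -S.liftNeg X := by
    rw [Module.End.mul_apply, hK hX, liftNeg_mem]
  have h1 := dorfman_mem_of_genNijenhuis S.genPos (hK hX) (hK hY)
  have h2 := dorfman_mem_of_genNijenhuis_neg S.genNeg (hGK hX) (hGK hY)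
  rw [Module.End.mul_apply, h1] at h2
  have h3 := S.eq_liftNeg h2
  rw [dorfman_fst, liftNeg_fst, liftNeg_fst] at h3
  refine ⟨h3, ?_⟩
  rw [h3] at h1
  change (S.K (S.liftNeg _)).1 = _
  rw [h1, liftNeg_fst]

theorem dorfman_liftNeg_neg {X Y : L} (hX : S.Kneg X = -X) (hY : S.Kneg Y = -Y) :
    dorfman H (S.liftNeg X) (S.liftNeg Y) = S.liftNeg ⁅X, Y⁆ ∧ S.Kneg ⁅X, Y⁆ = -⁅X, Y⁆ := by
  have hK {X : L} (hX : S.Kneg X = -X) : S.K (S.liftNeg X) = -S.liftNeg X := by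
    rw [K_liftNeg, hX, map_neg]
  have hGK {X : L} (hX : S.Kneg X = -X) : (S.G * S.K) (S.liftNeg X) = S.liftNeg X := by
    rw [Module.End.mul_apply, hK hX, map_neg, liftNeg_mem, neg_neg]
  have h1 := dorfman_mem_of_genNijenhuis_neg S.genPos (hK hX) (hK hY)
  have h2 := dorfman_mem_of_genNijenhuis S.genNeg (hGK hX) (hGK hY)
  rw [Module.End.mul_apply, h1, map_neg, neg_eq_iff_eq_neg] at h2
  have h3 := S.eq_liftNeg h2
  rw [dorfman_fst, liftNeg_fst, liftNeg_fst] at h3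
  refine ⟨h3, ?_⟩
  rw [h3] at h1
  change (S.K (S.liftNeg _)).1 = _
  rw [h1, Prod.fst_neg, liftNeg_fst]

/-- The para-Hermitian structure `(η, K₊)`. -/
def paraHermitianPos : ParaHermitian A L where
  η := S.eta
  symm := S.eta_symm
  nondeg := S.eta_bijective
  K := S.Kpos
  sq := S.Kpos_sq
  anti := S.eta_Kpos
  integrable := nijenhuis_eq_zero S.Kpos_sq (fun _ _ hX hY => (S.dorfman_liftPos hX hY).2)
    (fun _ _ hX hY => (S.dorfman_liftPos_neg hX hY).2)

/-- The para-Hermitian structure `(η, K₋)`. -/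
def paraHermitianNeg : ParaHermitian A L where
  η := S.eta
  symm := S.eta_symm
  nondeg := S.eta_bijective
  K := S.Kneg
  sq := S.Kneg_sq
  anti := S.eta_Kneg
  integrable := nijenhuis_eq_zero S.Kneg_sq (fun _ _ hX hY => (S.dorfman_liftNeg hX hY).2)
    (fun _ _ hX hY => (S.dorfman_liftNeg_neg hX hY).2)

theorem eta_dBracket_pos (X Y Z : L) : S.eta (S.paraHermitianPos.dBracket X Y) Z =
    (1 / 2 : ℝ) • pairing (dorfman H (S.liftPos X) (S.liftPos Y)) (S.liftPos Z) := by
  have h : (2 : ℤ) • S.eta (S.paraHermitianPos.dBracket X Y) Z = _ :=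
    S.paraHermitianPos.eta_dBracket S.liftPos_fst S.pairing_liftPos
      (fun _ _ hX hY => (S.dorfman_liftPos hX hY).1)
      (fun _ _ hX hY => (S.dorfman_liftPos_neg hX hY).1) X Y Z
  rw [← h]; module

theorem eta_dBracket_neg (X Y Z : L) : S.eta (S.paraHermitianNeg.dBracket X Y) Z =
    -((1 / 2 : ℝ) • pairing (dorfman H (S.liftNeg X) (S.liftNeg Y)) (S.liftNeg Z)) := by
  have h : (-2 : ℤ) • S.eta (S.paraHermitianNeg.dBracket X Y) Z = _ :=
    S.paraHermitianNeg.eta_dBracket S.liftNeg_fst S.pairing_liftNeg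
      (fun _ _ hX hY => (S.dorfman_liftNeg hX hY).1)
      (fun _ _ hX hY => (S.dorfman_liftNeg_neg hX hY).1) X Y Z
  rw [← h]; module

theorem projPos_eq_liftPos (u : GenT A L) : S.projPos u = S.liftPos (S.projPos u).1 :=
  S.eq_liftPos (by
    rw [projPos, LinearMap.map_smul_of_tower, map_add, S.metric.sq, add_comm])

theorem projNeg_eq_liftNeg (u : GenT A L) : S.projNeg u = S.liftNeg (S.projNeg u).1 :=
  S.eq_liftNeg (by
    rw [projNeg, LinearMap.map_smul_of_tower, map_sub, S.metric.sq]; module)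

/-- Pairing with `C₊` does not see the `C₋` component, since `G` is orthogonal and fixes `C₊`. -/
theorem pairing_projPos (u : GenT A L) (Z : L) :
    pairing (S.projPos u) (S.liftPos Z) = pairing u (S.liftPos Z) := by
  have h := S.metric.orth u (S.liftPos Z)
  rw [S.liftPos_mem] at h
  rw [projPos, pairing_smul_left, pairing_add_left, h]
  module

theorem pairing_projNeg (u : GenT A L) (Z : L) :
    pairing (S.projNeg u) (S.liftNeg Z) = pairing u (S.liftNeg Z) := by
  have h := S.metric.orth u (S.liftNeg Z)
  rw [S.liftNeg_mem, pairing_neg_right] at h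
  rw [projNeg, pairing_smul_left, sub_eq_add_neg, pairing_add_left, pairing_neg_left, h]
  module

/-- Both sides lie in `C₊`, so it suffices to compare tangent parts, which `η` separates. -/
theorem liftPos_dBracket (X Y : L) : S.liftPos (S.paraHermitianPos.dBracket X Y) =
    S.projPos (dorfman H (S.liftPos X) (S.liftPos Y)) := by
  rw [projPos_eq_liftPos]
  congr 1
  refine S.eta_bijective.1 (LinearMap.ext fun Z => ?_)
  rw [eta_dBracket_pos, ← pairing_projPos, projPos_eq_liftPos, pairing_liftPos, liftPos_fst]
  module

theorem liftNeg_dBracket (X Y : L) : S.liftNeg (S.paraHermitianNeg.dBracket X Y) =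
    S.projNeg (dorfman H (S.liftNeg X) (S.liftNeg Y)) := by
  rw [projNeg_eq_liftNeg]
  congr 1
  refine S.eta_bijective.1 (LinearMap.ext fun Z => ?_)
  rw [eta_dBracket_neg, ← pairing_projNeg, projNeg_eq_liftNeg, pairing_liftNeg, liftNeg_fst]
  module

/-! ### The relative flux -/

theorem b_swap (X Y : L) : S.b ![Y, X] = -S.b ![X, Y] := by
  rw [← S.b.map_swap ![X, Y] (show (0 : Fin 2) ≠ 1 by decide)]
  congr 1
  ext i; fin_cases i <;> rfl

theorem extD_two_form (θ : L [⋀^Fin 2]→ₗ[A] A) (X Y Z : L) :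
    extD θ ![X, Y, Z] = ⁅X, θ ![Y, Z]⁆ - ⁅Y, θ ![X, Z]⁆ + ⁅Z, θ ![X, Y]⁆
      - θ ![⁅X, Y⁆, Z] + θ ![⁅X, Z⁆, Y] - θ ![⁅Y, Z⁆, X] := by
  have e0 : (0 : Fin 3).removeNth ![X, Y, Z] = ![Y, Z] := by ext i; fin_cases i <;> rfl
  have e1 : (1 : Fin 3).removeNth ![X, Y, Z] = ![X, Z] := by ext i; fin_cases i <;> rfl
  have e2 : (2 : Fin 3).removeNth ![X, Y, Z] = ![X, Y] := by ext i; fin_cases i <;> rfl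
  have i0 : (Finset.Ici 0 : Finset (Fin 2)) = {0, 1} := by decide
  have i1 : (Finset.Ici 1 : Finset (Fin 2)) = {1} := by decide
  -- Removing an index from a pair leaves one entry, so each bracket term of `extD` is evaluated on
  -- an explicit pair.
  have hv (a : L) (i : Fin 2) (u : Fin 2 → L) :
      (Matrix.vecCons a (i.removeNth u) : Fin 2 → L) = ![a, i.removeNth u 0] := by
    ext j; fin_cases j <;> rfl
  rw [extD, Fin.sum_univ_three, Fin.sum_univ_two, i0, i1, Finset.sum_pair (by decide),
    Finset.sum_singleton, e0, e1, e2]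
  simp only [hv]
  change ((-1 : ℤ) ^ 0 • ⁅X, θ ![Y, Z]⁆ + (-1 : ℤ) ^ 1 • ⁅Y, θ ![X, Z]⁆
    + (-1 : ℤ) ^ 2 • ⁅Z, θ ![X, Y]⁆) - ((-1 : ℤ) ^ 0 • θ ![⁅X, Y⁆, Z]
    + (-1 : ℤ) ^ 1 • θ ![⁅X, Z⁆, Y] + (-1 : ℤ) ^ 2 • θ ![⁅Y, Z⁆, X]) = _
  module

theorem dftFlux_eq (X Y Z : L) : S.paraHermitianPos.dftFlux S.paraHermitianNeg X Y Z =
    H ![X, Y, Z] + extD S.b ![X, Y, Z] := by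
  change S.eta _ Z = _
  rw [map_sub, LinearMap.sub_apply, eta_dBracket_pos, eta_dBracket_neg, extD_two_form]
  simp only [pairing, dorfman_fst, dorfman_snd_apply, lieDer_apply, contrD_apply, contr₂_apply,
    liftPos_fst, liftNeg_fst, liftPos_snd, liftNeg_snd, lie_add, lie_sub]
  -- The bracket is put in the second slot of `b`, where the Dorfman side already has it.
  rw [S.b_swap X ⁅Y, Z⁆, S.b_swap Y ⁅X, Z⁆, S.b_swap Z ⁅X, Y⁆]
  module

end GenParaKahler
end Kahler
end ParaGeom

open ParaGeom

theorem mainTheorem8 {E : Type*} [NormedAddCommGroup E] [NormedSpace ℝ E] [FiniteDimensional ℝ E]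
    {B : Type*} [TopologicalSpace B] (I : ModelWithCorners ℝ E B)
    (M : Type*) [TopologicalSpace M] [T2Space M] [SigmaCompactSpace M] [ChartedSpace B M]
    [IsManifold I ∞ M] [BoundarylessManifold I M]
    (H : VF I M [⋀^Fin 3]→ₗ[SmoothFun I M] SmoothFun I M) (hH : IsClosedForm H)
    (S : GenParaKahler H) :
    ∃ P N : ParaHermitianStructure I M,
      P.η = S.eta ∧ P.K = S.Kpos ∧ N.η = S.eta ∧ N.K = S.Kneg ∧
      (∀ X Y Z : VF I M,
        S.eta (P.dBracket X Y) Z =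
          (1 / 2 : ℝ) • pairing (dorfman H (S.liftPos X) (S.liftPos Y)) (S.liftPos Z)) ∧
      (∀ X Y Z : VF I M,
        S.eta (N.dBracket X Y) Z =
          -((1 / 2 : ℝ) • pairing (dorfman H (S.liftNeg X) (S.liftNeg Y)) (S.liftNeg Z))) ∧
      (∀ X Y : VF I M,
        S.liftPos (P.dBracket X Y) = S.projPos (dorfman H (S.liftPos X) (S.liftPos Y))) ∧
      (∀ X Y : VF I M,
        S.liftNeg (N.dBracket X Y) = S.projNeg (dorfman H (S.liftNeg X) (S.liftNeg Y))) ∧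
      (∀ X Y Z : VF I M,
        P.dftFlux N.toParaHermitian X Y Z = H ![X, Y, Z] + extD S.b ![X, Y, Z]) :=
  ⟨⟨S.paraHermitianPos, finrank_fibre_eigenPos_eq _⟩,
    ⟨S.paraHermitianNeg, finrank_fibre_eigenPos_eq _⟩, rfl, rfl, rfl, rfl,
    S.eta_dBracket_pos, S.eta_dBracket_neg, S.liftPos_dBracket, S.liftNeg_dBracket, S.dftFlux_eq⟩
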